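/- For a nonzero polynomial $P \in \mathbb{C}[x_1,\dots,x_n]$ let $$m(P) = \int_0^1 \cdots \int_0^1 \log\left|P(e^{2\pi i\theta_1},\dots,e^{2\pi i\theta_n})\right| \, d\theta_1\cdots d\theta_n$$ denote its (logarithmic) Mahler measure. Then, for the four-variable polynomial $(1-x)(1-y)-(1-w)(1-z)$, the integrand is Lebesgue integrable on $[0,1]^4$ and $$m\bigl((1-x)(1-y)-(1-w)(1-z)\bigr) = \frac{9}{2\pi^2}\,\zeta(3),$$ where $\zeta$ is the Riemann zeta function. This polynomial is a reduced form of the determinant of the general $3\times 3$ matrix $(t_{ij})$, a polynomial in nine variables, in the following sense: the integrand defining $m(\det(t_{ij}))$ is Lebesgue integrable on $[0,1]^9$ and $$m\bigl(\det(t_{ij})_{1\le i,j\le 3}\bigr) = m\bigl((1-x)(1-y)-(1-w)(1-z)\bigr).$$ -/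

import Mathlib

/-- The function `θ ↦ log |P(exp(2πi θ₁), …, exp(2πi θₙ))|` attached to a complex polynomial `P`
in finitely many variables (indexed by `σ`). -/
noncomputable def logNormOnTorus {σ : Type*} (P : MvPolynomial σ ℂ) (θ : σ → ℝ) : ℝ :=
  Real.log ‖MvPolynomial.eval (fun i => Complex.exp (2 * Real.pi * Complex.I * (θ i : ℂ))) P‖

/-- The integral defining the Mahler measure of `P` converges absolutely: the integrand is
Lebesgue integrable on the unit cube `[0,1]^σ`. -/
def MahlerIntegrable {σ : Type*} [Fintype σ] (P : MvPolynomial σ ℂ) : Prop :=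
  MeasureTheory.IntegrableOn (logNormOnTorus P) (Set.Icc (0 : σ → ℝ) 1) MeasureTheory.volume

/-- The (logarithmic) Mahler measure
`m(P) = ∫_{[0,1]^σ} log |P(exp(2πi θ₁), …, exp(2πi θₙ))| dθ` of a nonzero complex polynomial. -/
noncomputable def mvLogMahlerMeasure {σ : Type*} [Fintype σ] (P : MvPolynomial σ ℂ) : ℝ :=
  ∫ θ in Set.Icc (0 : σ → ℝ) 1, logNormOnTorus P θ

/-- The polynomial `(1 - x)(1 - y) - (1 - w)(1 - z)`, with `x, y, w, z` the variables number
`0, 1, 2, 3`. -/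
noncomputable def fourVarPoly : MvPolynomial (Fin 4) ℂ :=
  (1 - MvPolynomial.X 0) * (1 - MvPolynomial.X 1) -
    (1 - MvPolynomial.X 2) * (1 - MvPolynomial.X 3)

/-- The determinant of the general `3 × 3` matrix, a polynomial in its nine entries. -/
noncomputable def genericDetThree : MvPolynomial (Fin 3 × Fin 3) ℂ :=
  (Matrix.mvPolynomialX (Fin 3) (Fin 3) ℂ).det

open MeasureTheory Set

/-! Write e(θ) for exp(2πiθ). On the torus put x = e(B-t+d), y = e(B-t-d), w = e(2B). The
four-variable polynomial is then a + b z with |b|² = 4(1 - cos² B) and |a|² = 4(cos² t + cos² d - 2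
cos t cos d cos B), the angles inside the cosines being in radians (`norm_linearCoeff_sq`,
`norm_constCoeff_sq`). Jensen's formula in z gives log|b| + log⁺(|a|/|b|). The first term has mean
0, so the Mahler measure is the mean of `halfPosLogRatio` at the cosines over (0, π)³.

In that cube |a| ≤ |b| exactly when t, d, B satisfy the three triangle inequalities and t + d + B ≤
2π. The rest consists of four simplices exchanged by symmetries of the integrand, so one of them, t
> d + B, suffices (`lintegral_halfPosLogRatio_cube`). There log(|a|/|b|) vanishes on the face t = d
+ B, hence equals the integral of `cosKernel u d B` over u from d + B to t. By Tonelli u is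
integrated last. The B-integral is (π/2 - u) tan u, which does not depend on d
(`lintegral_cosKernel`), so d and t contribute only the lengths u and π - u.

What remains is ∫ u(π - u)(π/2 - u) tan u over (0, π). The cubic is a multiple of the third
Bernoulli polynomial, with sine series ∑ sin(2nu)/n³, and ∫ sin(2nu) tan u = (-1)ⁿ⁻¹π, which gives
(9/8)π ζ(3) (`integral_cubic_mul_tan`). The factor 4/π³ turns this into the stated value.

For the determinant, scaling rows and columns by unimodular numbers makes the first row and column
1, and what is left is the four-variable polynomial in the remaining 2 × 2 block. The scaling map is
a surjective homomorphism of tori, so it preserves Haar measure. -/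

/-! ### The one-dimensional integral: a sine series against the tangent. -/

lemma abs_sin_two_mul_nat_mul_le (n : ℕ) (u : ℝ) :
    |Real.sin (2 * n * u)| ≤ 2 * n * |Real.cos u| := by
  induction n with
  | zero => simp
  | succ n ih =>
    have h1 : Real.sin (2 * ((n + 1 : ℕ) : ℝ) * u) =
        Real.sin (2 * n * u) * Real.cos (2 * u) +
          Real.cos (2 * n * u) * (2 * Real.sin u * Real.cos u) := by
      rw [← Real.sin_two_mul, ← Real.sin_add]; push_cast; ring_nf
    rw [h1]
    refine (abs_add_le _ _).trans ?_
    rw [abs_mul, abs_mul, abs_mul, abs_mul, abs_two]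
    have h2 := Real.abs_cos_le_one (2 * u)
    have h3 := Real.abs_cos_le_one (2 * n * u)
    have h4 := Real.abs_sin_le_one u
    have h5 : |Real.sin (2 * n * u)| * |Real.cos (2 * u)| ≤ 2 * n * |Real.cos u| :=
      (mul_le_of_le_one_right (abs_nonneg _) h2).trans ih
    have h6 : |Real.cos (2 * n * u)| * (2 * |Real.sin u| * |Real.cos u|) ≤ 2 * |Real.cos u| := by
      refine (mul_le_of_le_one_left (by positivity) h3).trans ?_
      nlinarith [abs_nonneg (Real.cos u)]
    push_cast
    linarith

/-- The zero of sin(2nu) cancels the pole of tan. Linear growth in n is harmless next to the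
coefficients 1/n³. -/
lemma abs_sin_two_mul_nat_mul_mul_tan_le (n : ℕ) (u : ℝ) :
    |Real.sin (2 * n * u) * Real.tan u| ≤ 2 * n := by
  rcases eq_or_ne (Real.cos u) 0 with h | h
  · rw [Real.tan_eq_sin_div_cos, h]; simp
  · rw [Real.tan_eq_sin_div_cos, abs_mul, abs_div, mul_div_assoc', div_le_iff₀ (abs_pos.2 h)]
    exact (mul_le_of_le_one_right (abs_nonneg _) (Real.abs_sin_le_one u)).trans
      (abs_sin_two_mul_nat_mul_le n u)

lemma measurable_tan : Measurable Real.tan := by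
  have : Real.tan = fun x => Real.sin x / Real.cos x := funext Real.tan_eq_sin_div_cos
  rw [this]; fun_prop

lemma integrableOn_sin_mul_tan (n : ℕ) :
    IntegrableOn (fun u => Real.sin (2 * n * u) * Real.tan u) (Ioo 0 Real.pi) := by
  refine IntegrableOn.of_bound (C := 2 * n) (by simp) ?_ ?_
  · have := measurable_tan
    exact Measurable.aestronglyMeasurable (by fun_prop)
  · exact Filter.Eventually.of_forall fun u => abs_sin_two_mul_nat_mul_mul_tan_le n u

lemma integral_cos_two_mul_nat_mul (n : ℕ) (hn : n ≠ 0) :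
    ∫ u in (0 : ℝ)..Real.pi, Real.cos (2 * n * u) = 0 := by
  have hn' : (n : ℝ) ≠ 0 := by exact_mod_cast hn
  rw [intervalIntegral.integral_comp_mul_left (fun u => Real.cos u) (by positivity)]
  rw [integral_cos]
  have : Real.sin (2 * n * Real.pi) = 0 := by
    have := Real.sin_nat_mul_pi (2 * n)
    push_cast at this
    exact this
  simp [this]

lemma ae_restrict_cos_ne_zero : ∀ᵐ u ∂(volume : Measure ℝ).restrict (Ioo 0 Real.pi),
    Real.cos u ≠ 0 := by
  have h : ∀ᵐ u ∂(volume : Measure ℝ).restrict (Ioo 0 Real.pi), u ≠ Real.pi / 2 :=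
    ae_restrict_of_ae (by simp [ae_iff])
  filter_upwards [h, ae_restrict_mem measurableSet_Ioo] with u hu hmem h0
  apply hu
  have := Real.injOn_cos ⟨hmem.1.le, hmem.2.le⟩
    (⟨by positivity, by linarith [Real.pi_pos]⟩ : Real.pi / 2 ∈ Icc 0 Real.pi)
  exact this (by rw [h0, Real.cos_pi_div_two])

/-- Adding consecutive sines produces a factor cos u that cancels the denominator of tan u, leaving
cos(2nu) - cos(2(n+1)u). -/
lemma integral_sin_mul_tan_succ_add (n : ℕ) :
    (∫ u in Ioo 0 Real.pi, Real.sin (2 * (n + 1 : ℕ) * u) * Real.tan u) +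
      ∫ u in Ioo 0 Real.pi, Real.sin (2 * n * u) * Real.tan u = if n = 0 then Real.pi else 0 := by
  rw [← integral_add (integrableOn_sin_mul_tan (n + 1)) (integrableOn_sin_mul_tan n)]
  have h : (fun u => Real.sin (2 * (n + 1 : ℕ) * u) * Real.tan u +
      Real.sin (2 * n * u) * Real.tan u) =ᵐ[volume.restrict (Ioo 0 Real.pi)]
      fun u => Real.cos (2 * n * u) - Real.cos (2 * (n + 1 : ℕ) * u) := by
    filter_upwards [ae_restrict_cos_ne_zero] with u hu
    rw [← add_mul, Real.sin_add_sin, Real.cos_sub_cos, Real.tan_eq_sin_div_cos]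
    have e1 : (2 * ((n + 1 : ℕ) : ℝ) * u - 2 * n * u) / 2 = u := by push_cast; ring
    have e2 : (2 * (n : ℝ) * u - 2 * (n + 1 : ℕ) * u) / 2 = -u := by push_cast; ring
    have e3 : (2 * (n : ℝ) * u + 2 * (n + 1 : ℕ) * u) = 2 * (n + 1 : ℕ) * u + 2 * n * u := by ring
    rw [e1, e2, e3, Real.sin_neg]
    field_simp
  rw [integral_congr_ae h, ← integral_Ioc_eq_integral_Ioo,
    ← intervalIntegral.integral_of_le Real.pi_pos.le, intervalIntegral.integral_sub
      (Continuous.intervalIntegrable (by fun_prop) _ _)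
      (Continuous.intervalIntegrable (by fun_prop) _ _),
    integral_cos_two_mul_nat_mul _ (Nat.succ_ne_zero n)]
  rcases eq_or_ne n 0 with rfl | hn
  · simp
  · rw [integral_cos_two_mul_nat_mul _ hn]; simp [hn]

lemma integral_sin_mul_tan (n : ℕ) :
    ∫ u in Ioo 0 Real.pi, Real.sin (2 * (n + 1 : ℕ) * u) * Real.tan u = (-1) ^ n * Real.pi := by
  induction n with
  | zero => simpa using integral_sin_mul_tan_succ_add 0
  | succ n ih =>
    have := integral_sin_mul_tan_succ_add (n + 1)
    rw [ih, if_neg (Nat.succ_ne_zero n)] at this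
    rw [pow_succ]; linarith

/-- This is the Fourier series of the Bernoulli polynomial B₃(X) = X(X - 1)(X - 1/2) at X = u/π. -/
lemma hasSum_sin_div_cube {u : ℝ} (hu : u ∈ Icc 0 Real.pi) :
    HasSum (fun n : ℕ => 1 / (n : ℝ) ^ 3 * Real.sin (2 * n * u))
      (2 / 3 * (u * (Real.pi - u) * (Real.pi / 2 - u))) := by
  have hx : u / Real.pi ∈ Icc (0 : ℝ) 1 :=
    ⟨div_nonneg hu.1 Real.pi_pos.le, div_le_one_of_le₀ hu.2 Real.pi_pos.le⟩
  have h := hasSum_one_div_nat_pow_mul_sin one_ne_zero hx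
  have hpi := Real.pi_ne_zero
  convert! h using 1
  · ext n
    congr 2
    field_simp
  · have : (Polynomial.map (algebraMap ℚ ℝ) (Polynomial.bernoulli (2 * 1 + 1))).eval (u / Real.pi)
        = (u / Real.pi) * (u / Real.pi - 1) * (u / Real.pi - 1 / 2) := by
      have hb : bernoulli 3 = 0 := by
        rw [bernoulli_eq_bernoulli'_of_ne_one (by norm_num), bernoulli'_three]
      norm_num [Polynomial.bernoulli, Finset.sum_range_succ, Finset.sum_range_zero, hb,
        bernoulli_one, bernoulli_two, Nat.choose, Polynomial.eval_add]
      ring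
    rw [this]
    norm_num [Nat.factorial]
    field_simp
    ring

/-- The terms with even denominator make up 1/8 of the full sum, and reversing their sign removes
them twice: 1 - 2/8 = 3/4. -/
lemma hasSum_alternating_cube :
    HasSum (fun n : ℕ => (-1 : ℝ) ^ n / ((n : ℝ) + 1) ^ 3)
      (3 / 4 * ∑' n : ℕ, 1 / ((n : ℝ) + 1) ^ 3) := by
  have hs0 : Summable (fun n : ℕ => 1 / ((n : ℝ)) ^ 3) :=
    Real.summable_one_div_nat_pow.2 (by norm_num)
  have hs : Summable (fun n : ℕ => 1 / ((n : ℝ) + 1) ^ 3) := by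
    have := (summable_nat_add_iff 1).2 hs0
    simpa using this
  have he : Summable (fun n : ℕ => 1 / (((2 * n : ℕ) : ℝ) + 1) ^ 3) :=
    hs.comp_injective (i := fun n => 2 * n) (fun a b h => by simpa using h)
  have ho : HasSum (fun n : ℕ => 1 / (((2 * n + 1 : ℕ) : ℝ) + 1) ^ 3)
      (1 / 8 * ∑' n : ℕ, 1 / ((n : ℝ) + 1) ^ 3) := by
    convert! hs.hasSum.mul_left (1 / 8) using 1
    ext n
    push_cast
    rw [show (2 * (n : ℝ) + 1 + 1) = 2 * (n + 1) by ring, mul_pow]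
    field_simp
    norm_num
  have htot := (he.hasSum.even_add_odd (f := fun n : ℕ => 1 / ((n : ℝ) + 1) ^ 3) ho).tsum_eq
  have := HasSum.even_add_odd (f := fun n : ℕ => (-1 : ℝ) ^ n / ((n : ℝ) + 1) ^ 3)
    (m := ∑' n : ℕ, 1 / (((2 * n : ℕ) : ℝ) + 1) ^ 3)
    (m' := -(1 / 8 * ∑' n : ℕ, 1 / ((n : ℝ) + 1) ^ 3))
    (by convert! he.hasSum using 1; ext n; simp [pow_mul])
    (by convert! ho.neg using 1; ext n; simp [pow_mul, pow_succ, neg_div])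
  convert! this using 1
  linarith

lemma integral_cubic_mul_tan :
    ∫ u in Ioo 0 Real.pi, u * (Real.pi - u) * (Real.pi / 2 - u) * Real.tan u =
      9 / 8 * Real.pi * ∑' n : ℕ, 1 / ((n : ℝ) + 1) ^ 3 := by
  set F : ℕ → ℝ → ℝ := fun n u =>
    1 / ((n + 1 : ℕ) : ℝ) ^ 3 * (Real.sin (2 * (n + 1 : ℕ) * u) * Real.tan u) with hF
  have hint : ∀ n, IntegrableOn (F n) (Ioo 0 Real.pi) := fun n =>
    (integrableOn_sin_mul_tan (n + 1)).const_mul _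
  have hsum2 : Summable (fun n : ℕ => 1 / ((n + 1 : ℕ) : ℝ) ^ 2) :=
    (summable_nat_add_iff 1).2 (Real.summable_one_div_nat_pow.2 (by norm_num))
  have hnorm : Summable fun n => ∫ u in Ioo 0 Real.pi, ‖F n u‖ := by
    refine Summable.of_nonneg_of_le (fun n => by positivity) (fun n => ?_)
      (hsum2.mul_left (2 * Real.pi))
    have hb : ∀ u, ‖F n u‖ ≤ 2 / ((n + 1 : ℕ) : ℝ) ^ 2 := by
      intro u
      rw [hF, norm_mul, Real.norm_of_nonneg (by positivity)]
      refine (mul_le_mul_of_nonneg_left (abs_sin_two_mul_nat_mul_mul_tan_le (n + 1) u)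
        (by positivity)).trans (le_of_eq ?_)
      field_simp
    refine (setIntegral_mono_on (hint n).norm (g := fun _ => 2 / ((n + 1 : ℕ) : ℝ) ^ 2) (by simp)
      measurableSet_Ioo (fun u _ => hb u)).trans (le_of_eq ?_)
    simp [Real.pi_pos.le]
    ring
  have h := hasSum_integral_of_summable_integral_norm hint hnorm
  have h1 : (fun n => ∫ u in Ioo 0 Real.pi, F n u) =
      fun n : ℕ => Real.pi * ((-1 : ℝ) ^ n / ((n : ℝ) + 1) ^ 3) := by
    ext n
    rw [hF]
    simp only
    rw [integral_const_mul, integral_sin_mul_tan]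
    push_cast
    ring
  rw [h1] at h
  have h2 := h.unique (hasSum_alternating_cube.mul_left Real.pi)
  have h3 : ∫ u in Ioo 0 Real.pi, ∑' n, F n u = ∫ u in Ioo 0 Real.pi,
      2 / 3 * (u * (Real.pi - u) * (Real.pi / 2 - u) * Real.tan u) := by
    refine setIntegral_congr_fun measurableSet_Ioo fun u hu => ?_
    have hh := (hasSum_sin_div_cube ⟨hu.1.le, hu.2.le⟩).mul_right (Real.tan u)
    -- The sine series starts at n = 0, where its term vanishes, while `F` starts at frequency 1.
    rw [← hasSum_nat_add_iff' 1] at hh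
    simp only [Finset.range_one, Finset.sum_singleton] at hh
    have := hh.tsum_eq
    simp only [hF, ← mul_assoc]
    rw [this, show Real.sin (2 * ((0 : ℕ) : ℝ) * u) = 0 by simp]
    ring
  rw [h3, integral_const_mul] at h2
  linarith

/-! ### The kernel and its integrals in u and in B. -/

/-- Half the positive logarithm of `(a² + b² - 2abc) / (1 - c²)`. -/
noncomputable def halfPosLogRatio (a b c : ℝ) : ℝ :=
  2⁻¹ * Real.posLog ((a ^ 2 + b ^ 2 - 2 * a * b * c) / (1 - c ^ 2))

/-- The derivative in `u` of `½ log (cos² u + cos² d - 2 cos u cos d cos B)`. -/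
noncomputable def cosKernel (u d B : ℝ) : ℝ :=
  Real.sin u * (Real.cos d * Real.cos B - Real.cos u) /
    (Real.cos u ^ 2 + Real.cos d ^ 2 - 2 * Real.cos u * Real.cos d * Real.cos B)

/-- Since cos u ≤ cos(d + B) = cos d cos B - sin d sin B. This gives the sign of the numerator of
`cosKernel` and, by completing the square, that of its denominator. -/
lemma cos_lt_cos_mul_cos {u d B : ℝ} (hd : 0 < d) (hB : 0 ≤ B) (h : d + B ≤ u) (hdu : d < u)
    (hu : u ≤ Real.pi) : Real.cos u < Real.cos d * Real.cos B := by
  rcases hB.eq_or_lt with rfl | hB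
  · rw [Real.cos_zero, mul_one]
    exact Real.cos_lt_cos_of_nonneg_of_le_pi hd.le hu hdu
  · have h1 := Real.cos_le_cos_of_nonneg_of_le_pi (by linarith) hu h
    rw [Real.cos_add] at h1
    have h2 := Real.sin_pos_of_pos_of_lt_pi hd (by linarith)
    have h3 := Real.sin_pos_of_pos_of_lt_pi hB (by linarith)
    nlinarith [mul_pos h2 h3]

lemma quadratic_pos_of_lt {a b c : ℝ} (hc : |c| ≤ 1) (h : a < b * c) :
    0 < a ^ 2 + b ^ 2 - 2 * a * b * c := by
  have h1 : 0 < (b * c - a) ^ 2 := pow_pos (sub_pos.2 h) 2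
  have h2 : c ^ 2 ≤ 1 := (sq_le_one_iff_abs_le_one c).2 hc
  nlinarith [mul_nonneg (sq_nonneg b) (sub_nonneg.2 h2)]

lemma cosKernel_nonneg {u d B : ℝ} (hd : 0 < d) (hB : 0 ≤ B) (h : d + B ≤ u) (hdu : d < u)
    (hu : u ≤ Real.pi) : 0 ≤ cosKernel u d B := by
  have h1 := cos_lt_cos_mul_cos hd hB h hdu hu
  refine div_nonneg (mul_nonneg (Real.sin_nonneg_of_nonneg_of_le_pi (by linarith) hu)
    (sub_nonneg.2 h1.le)) (quadratic_pos_of_lt (Real.abs_cos_le_one B) h1).le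

lemma lintegral_Ioo_ofReal_eq_of_hasDerivAt {f F : ℝ → ℝ} {a b : ℝ} (hab : a ≤ b)
    (hcont : ContinuousOn f (Icc a b)) (hnn : ∀ x ∈ Icc a b, 0 ≤ f x)
    (hderiv : ∀ x ∈ Icc a b, HasDerivAt F (f x) x) :
    ∫⁻ x in Ioo a b, ENNReal.ofReal (f x) = ENNReal.ofReal (F b - F a) := by
  have hint : IntegrableOn f (Ioo a b) :=
    (hcont.integrableOn_compact isCompact_Icc).mono_set Ioo_subset_Icc_self
  rw [← ofReal_integral_eq_lintegral_ofReal hint, ← integral_Ioc_eq_integral_Ioo,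
    ← intervalIntegral.integral_of_le hab, intervalIntegral.integral_eq_sub_of_hasDerivAt]
  · rwa [uIcc_of_le hab]
  · exact ContinuousOn.intervalIntegrable (by rwa [uIcc_of_le hab])
  · filter_upwards [ae_restrict_mem measurableSet_Ioo] with x hx
    exact hnn x (Ioo_subset_Icc_self hx)

/-- The factorization decides on which side of 1 the ratio in `halfPosLogRatio` lies: the factors
change sign on the faces t - d = ±B, t + d = B and t + d = 2π - B. -/
lemma one_sub_sq_sub_quadratic (t d B : ℝ) :
    (1 - Real.cos B ^ 2) -
        (Real.cos t ^ 2 + Real.cos d ^ 2 - 2 * Real.cos t * Real.cos d * Real.cos B) =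
      (Real.cos (t - d) - Real.cos B) * (Real.cos B - Real.cos (t + d)) := by
  rw [Real.cos_sub, Real.cos_add]
  have : Real.sin t ^ 2 * Real.sin d ^ 2 = (1 - Real.cos t ^ 2) * (1 - Real.cos d ^ 2) := by
    rw [← Real.sin_sq, ← Real.sin_sq]
  linear_combination -this

lemma ofReal_halfPosLogRatio_eq_lintegral {t d B : ℝ} (hd : 0 < d) (hB : 0 < B) (h : d + B < t)
    (ht : t < Real.pi) :
    ENNReal.ofReal (halfPosLogRatio (Real.cos t) (Real.cos d) (Real.cos B)) =
      ∫⁻ u in Ioo (d + B) t, ENNReal.ofReal (cosKernel u d B) := by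
  set N : ℝ → ℝ := fun u =>
    Real.cos u ^ 2 + Real.cos d ^ 2 - 2 * Real.cos u * Real.cos d * Real.cos B with hN
  have hNpos : ∀ u ∈ Icc (d + B) t, 0 < N u := fun u hu =>
    quadratic_pos_of_lt (Real.abs_cos_le_one B)
      (cos_lt_cos_mul_cos hd hB.le hu.1 (by linarith [hu.1]) (by linarith [hu.2]))
  have hN0 : N (d + B) = 1 - Real.cos B ^ 2 := by
    have := one_sub_sq_sub_quadratic (d + B) d B
    rw [show d + B - d = B by ring, sub_self, zero_mul] at this
    rw [hN]; linarith
  have hs : 0 < 1 - Real.cos B ^ 2 := hN0 ▸ hNpos _ ⟨le_rfl, h.le⟩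
  rw [lintegral_Ioo_ofReal_eq_of_hasDerivAt (F := fun u => 2⁻¹ * Real.log (N u)) h.le]
  · have hle : 1 ≤ N t / (1 - Real.cos B ^ 2) := by
      rw [one_le_div hs]
      have := one_sub_sq_sub_quadratic t d B
      have h1 := Real.cos_lt_cos_of_nonneg_of_le_pi hB.le (by linarith : t - d ≤ Real.pi)
        (by linarith)
      have h2 : Real.cos (t + d) ≤ Real.cos B := by
        rcases le_total (t + d) Real.pi with h3 | h3
        · exact Real.cos_le_cos_of_nonneg_of_le_pi hB.le h3 (by linarith)
        · rw [← Real.cos_two_pi_sub]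
          exact Real.cos_le_cos_of_nonneg_of_le_pi hB.le (by linarith) (by linarith)
      nlinarith [mul_nonneg (sub_nonneg.2 h1.le) (sub_nonneg.2 h2)]
    rw [halfPosLogRatio, Real.posLog_eq_log (hle.trans (le_abs_self _)),
      Real.log_div (hNpos t ⟨h.le, le_rfl⟩).ne' hs.ne', ← hN0, mul_sub]
  · refine ContinuousOn.div (by fun_prop) (by fun_prop) fun u hu => (hNpos u hu).ne'
  · exact fun u hu => cosKernel_nonneg hd hB.le hu.1 (by linarith [hu.1]) (by linarith [hu.2])
  · intro u hu
    have h1 : HasDerivAt N (2 * Real.cos u * (-Real.sin u) -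
        2 * (-Real.sin u) * Real.cos d * Real.cos B) u := by
      have := (((Real.hasDerivAt_cos u).pow 2).add_const (Real.cos d ^ 2)).sub
        ((((Real.hasDerivAt_cos u).const_mul 2).mul_const (Real.cos d)).mul_const (Real.cos B))
      convert! this using 1
      push_cast
      ring
    convert! (h1.log (hNpos u hu).ne').const_mul (2⁻¹ : ℝ) using 1
    rw [cosKernel]
    have := (hNpos u hu).ne'
    rw [mul_div_assoc', div_left_inj' this]
    ring

/-- The quotient of cosines is -cot((u + d)/2) cot((u - d)/2). This evaluates the arctangent in
`lintegral_cosKernel` at the endpoint B = u - d. -/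
lemma tan_half_sub_mul {u d : ℝ} (h1 : Real.sin ((u + d) / 2) ≠ 0)
    (h2 : Real.sin ((u - d) / 2) ≠ 0) (h3 : Real.cos ((u - d) / 2) ≠ 0) :
    (Real.cos u + Real.cos d) / (Real.cos u - Real.cos d) * Real.tan ((u - d) / 2) =
      Real.tan ((u + d) / 2 - Real.pi / 2) := by
  rw [Real.cos_add_cos, Real.cos_sub_cos, Real.tan_eq_sin_div_cos, Real.tan_eq_sin_div_cos,
    Real.sin_sub_pi_div_two, Real.cos_sub_pi_div_two]
  field_simp

lemma lintegral_cosKernel {u d : ℝ} (hd : 0 < d) (hdu : d < u) (hu : u < Real.pi)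
    (hcos : Real.cos u ≠ 0) :
    ∫⁻ B in Ioo 0 (u - d), ENNReal.ofReal (cosKernel u d B) =
      ENNReal.ofReal ((Real.pi / 2 - u) * Real.tan u) := by
  have hne : Real.cos u - Real.cos d ≠ 0 :=
    (sub_neg.2 (Real.cos_lt_cos_of_nonneg_of_le_pi hd.le hu.le hdu)).ne
  have hpos : ∀ B ∈ Icc 0 (u - d),
      0 < Real.cos u ^ 2 + Real.cos d ^ 2 - 2 * Real.cos u * Real.cos d * Real.cos B :=
    fun B hB => quadratic_pos_of_lt (Real.abs_cos_le_one B)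
      (cos_lt_cos_mul_cos hd hB.1 (by linarith [hB.2]) hdu hu.le)
  set κ := (Real.cos u + Real.cos d) / (Real.cos u - Real.cos d) with hκ
  -- Antiderivative from the substitution tan(B/2). At B = u - d the bracket is (u - d)/2 + (u +
  -- d)/2 - π/2, so d cancels.
  rw [lintegral_Ioo_ofReal_eq_of_hasDerivAt (F := fun B =>
    -Real.tan u * (B / 2 + Real.arctan (κ * Real.tan (B / 2)))) (by linarith)]
  · congr 1
    rw [hκ, tan_half_sub_mul, Real.arctan_tan]
    · simp; ring
    · linarith
    · linarith
    · exact (Real.sin_pos_of_pos_of_lt_pi (by linarith) (by linarith)).ne'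
    · exact (Real.sin_pos_of_pos_of_lt_pi (by linarith) (by linarith)).ne'
    · exact (Real.cos_pos_of_mem_Ioo ⟨by linarith, by linarith⟩).ne'
  · refine ContinuousOn.div (by fun_prop) (by fun_prop) fun B hB => (hpos B hB).ne'
  · exact fun B hB => cosKernel_nonneg hd hB.1 (by linarith [hB.2]) hdu hu.le
  · intro B hB
    have hc : Real.cos (B / 2) ≠ 0 :=
      (Real.cos_pos_of_mem_Ioo ⟨by linarith [hB.1, Real.pi_pos], by linarith [hB.2]⟩).ne'
    have h1 : HasDerivAt (fun B : ℝ => B / 2) (1 / 2) B := (hasDerivAt_id B).div_const 2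
    have h2 : HasDerivAt (fun B : ℝ => Real.tan (B / 2)) (1 / Real.cos (B / 2) ^ 2 * (1 / 2)) B :=
      HasDerivAt.comp (h₂ := Real.tan) B (Real.hasDerivAt_tan hc) h1
    have h3 := (h1.add (h2.const_mul κ).arctan).const_mul (-Real.tan u)
    convert! h3 using 1
    have hp := (hpos B hB).ne'
    have hcB : Real.cos B = Real.cos (B / 2) ^ 2 - Real.sin (B / 2) ^ 2 := by
      rw [← Real.cos_two_mul']; ring_nf
    have hsc := Real.sin_sq_add_cos_sq (B / 2)
    have key : 1 + (κ * Real.tan (B / 2)) ^ 2 =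
        (Real.cos u ^ 2 + Real.cos d ^ 2 - 2 * Real.cos u * Real.cos d * Real.cos B) /
          ((Real.cos u - Real.cos d) ^ 2 * Real.cos (B / 2) ^ 2) := by
      rw [hκ, Real.tan_eq_sin_div_cos, hcB]
      field_simp
      linear_combination (Real.cos u ^ 2 + Real.cos d ^ 2) * hsc
    rw [key, cosKernel, hκ, Real.tan_eq_sin_div_cos]
    generalize hN : Real.cos u ^ 2 + Real.cos d ^ 2 - 2 * Real.cos u * Real.cos d * Real.cos B = N
      at hp ⊢
    field_simp
    rw [← hN]
    ring

/-! ### The integral over the cube: Tonelli and symmetry. -/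

/-- Lebesgue measure on the interval `(0, π)`. -/
noncomputable abbrev volumeZeroPi : Measure ℝ := volume.restrict (Ioo 0 Real.pi)

/-- Lebesgue measure on the cube `(0, π)³`. -/
noncomputable abbrev volumeCube : Measure ((ℝ × ℝ) × ℝ) :=
  (volumeZeroPi.prod volumeZeroPi).prod volumeZeroPi

lemma ae_volumeCube_mem : ∀ᵐ p ∂volumeCube,
    (p.1.1 ∈ Ioo 0 Real.pi ∧ p.1.2 ∈ Ioo 0 Real.pi) ∧ p.2 ∈ Ioo 0 Real.pi := by
  rw [volumeCube, volumeZeroPi, Measure.prod_restrict, Measure.prod_restrict]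
  filter_upwards [ae_restrict_mem ((measurableSet_Ioo.prod measurableSet_Ioo).prod
    measurableSet_Ioo)] with p hp
  exact hp

lemma measurable_halfPosLogRatio : Measurable fun p : (ℝ × ℝ) × ℝ =>
    halfPosLogRatio p.1.1 p.1.2 p.2 := by
  have := Real.continuous_posLog.measurable
  unfold halfPosLogRatio
  fun_prop

lemma measurable_halfPosLogRatio_cos : Measurable fun p : (ℝ × ℝ) × ℝ =>
    ENNReal.ofReal (halfPosLogRatio (Real.cos p.1.1) (Real.cos p.1.2) (Real.cos p.2)) := by
  have h : Measurable fun p : (ℝ × ℝ) × ℝ =>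
    ((Real.cos p.1.1, Real.cos p.1.2), Real.cos p.2) := by fun_prop
  exact (measurable_halfPosLogRatio.comp h).ennreal_ofReal

lemma lintegral_volumeZeroPi_ite {s : Set ℝ} (f : ℝ → ENNReal) [DecidablePred (· ∈ s)]
    (hs : MeasurableSet s) (hsub : s ⊆ Ioo 0 Real.pi) :
    ∫⁻ x, (if x ∈ s then f x else 0) ∂volumeZeroPi = ∫⁻ x in s, f x := by
  have : (fun x => if x ∈ s then f x else 0) = s.indicator f := by
    ext x; rw [indicator_apply]
  rw [this, lintegral_indicator hs, Measure.restrict_restrict_of_subset hsub]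

lemma lintegral_cube_cosKernel {u : ℝ} (hu : u ∈ Ioo 0 Real.pi) (hcos : Real.cos u ≠ 0) :
    ∫⁻ p, (if p.1.2 + p.2 < u ∧ u < p.1.1 then ENNReal.ofReal (cosKernel u p.1.2 p.2) else 0)
      ∂volumeCube =
      ENNReal.ofReal (u * (Real.pi - u) * (Real.pi / 2 - u) * Real.tan u) := by
  classical
  have hmk : Measurable fun p : (ℝ × ℝ) × ℝ => cosKernel u p.1.2 p.2 := by
    unfold cosKernel; fun_prop
  have hm : Measurable fun p : (ℝ × ℝ) × ℝ =>
      if p.1.2 + p.2 < u ∧ u < p.1.1 then ENNReal.ofReal (cosKernel u p.1.2 p.2) else 0 := by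
    refine Measurable.ite ?_ hmk.ennreal_ofReal measurable_const
    rw [ofPred_and]
    refine (measurableSet_lt ?_ ?_).inter (measurableSet_lt ?_ ?_) <;> fun_prop
  set C := ENNReal.ofReal ((Real.pi / 2 - u) * Real.tan u) with hC
  rw [lintegral_prod _ hm.aemeasurable, lintegral_prod _ (hm.lintegral_prod_right').aemeasurable]
  have h1 : ∀ t, ∀ d ∈ Ioo 0 Real.pi, ∫⁻ B, (if d + B < u ∧ u < t then
      ENNReal.ofReal (cosKernel u d B) else 0) ∂volumeZeroPi =
      if d ∈ Ioo 0 u then (if u < t then C else 0) else 0 := by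
    intro t d hd
    by_cases ht : u < t
    · by_cases hdu : d < u
      · rw [if_pos ⟨hd.1, hdu⟩, if_pos ht, hC, ← lintegral_cosKernel hd.1 hdu hu.2 hcos,
          ← lintegral_volumeZeroPi_ite (s := Ioo 0 (u - d)) _ measurableSet_Ioo
            (Ioo_subset_Ioo le_rfl (by linarith [hu.2, hd.1]))]
        refine setLIntegral_congr_fun measurableSet_Ioo fun B hB => ?_
        have : (d + B < u ∧ u < t) ↔ B ∈ Ioo 0 (u - d) :=
          ⟨fun h => ⟨hB.1, by linarith [h.1]⟩, fun h => ⟨by linarith [h.2], ht⟩⟩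
        simp only [this]
      · rw [if_neg fun h => hdu h.2]
        refine (setLIntegral_congr_fun (g := fun _ => 0) measurableSet_Ioo fun B hB => ?_).trans
          (by simp)
        exact if_neg fun h => by linarith [h.1, hB.1]
    · simp [ht]
  have h2 : ∀ t ∈ Ioo 0 Real.pi, ∫⁻ d, (∫⁻ B, (if d + B < u ∧ u < t then
      ENNReal.ofReal (cosKernel u d B) else 0) ∂volumeZeroPi) ∂volumeZeroPi =
      if t ∈ Ioo u Real.pi then C * ENNReal.ofReal u else 0 := by
    intro t ht
    rw [setLIntegral_congr_fun measurableSet_Ioo (h1 t),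
      lintegral_volumeZeroPi_ite _ measurableSet_Ioo (Ioo_subset_Ioo le_rfl hu.2.le)]
    rcases lt_or_ge u t with h | h
    · simp [h, ht.2]
    · simp [h.not_gt]
  rw [setLIntegral_congr_fun measurableSet_Ioo h2,
    lintegral_volumeZeroPi_ite _ measurableSet_Ioo (Ioo_subset_Ioo hu.1.le le_rfl)]
  rw [setLIntegral_const, Real.volume_Ioo, hC, mul_assoc, ← ENNReal.ofReal_mul hu.1.le, mul_comm,
    ← ENNReal.ofReal_mul (mul_nonneg hu.1.le (by linarith [hu.2]))]
  congr 1
  ring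

lemma half_pi_sub_mul_tan_nonneg {u : ℝ} (hu : u ∈ Ioo 0 Real.pi) :
    0 ≤ (Real.pi / 2 - u) * Real.tan u := by
  rcases le_total u (Real.pi / 2) with h | h
  · exact mul_nonneg (by linarith) (Real.tan_nonneg_of_nonneg_of_le_pi_div_two hu.1.le h)
  · rw [← Real.tan_sub_pi]
    exact mul_nonneg_of_nonpos_of_nonpos (by linarith)
      (Real.tan_nonpos_of_nonpos_of_neg_pi_div_two_le (by linarith [hu.2]) (by linarith))

/-- A non-integrable function would have Bochner integral 0 by convention, but
`integral_cubic_mul_tan` gives a positive value. -/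
lemma integrableOn_cubic_mul_tan :
    IntegrableOn (fun u => u * (Real.pi - u) * (Real.pi / 2 - u) * Real.tan u)
      (Ioo 0 Real.pi) := by
  by_contra h
  have h1 := integral_cubic_mul_tan
  rw [integral_undef h] at h1
  have hs : Summable (fun n : ℕ => 1 / ((n : ℝ) + 1) ^ 3) := by
    have := (summable_nat_add_iff 1).2 (Real.summable_one_div_nat_pow.2 (by norm_num : 1 < 3))
    simpa using this
  have h2 := hs.tsum_pos (fun n => by positivity) 0 (by norm_num)
  have : 0 < 9 / 8 * Real.pi * ∑' n : ℕ, 1 / ((n : ℝ) + 1) ^ 3 := by positivity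
  linarith

lemma lintegral_halfPosLogRatio_region :
    ∫⁻ p, (if p.1.2 + p.2 < p.1.1 then
      ENNReal.ofReal (halfPosLogRatio (Real.cos p.1.1) (Real.cos p.1.2) (Real.cos p.2)) else 0)
        ∂volumeCube =
      ENNReal.ofReal (9 / 8 * Real.pi * ∑' n : ℕ, 1 / ((n : ℝ) + 1) ^ 3) := by
  classical
  have h1 : ∀ᵐ p ∂volumeCube, (if p.1.2 + p.2 < p.1.1 then
      ENNReal.ofReal (halfPosLogRatio (Real.cos p.1.1) (Real.cos p.1.2) (Real.cos p.2)) else 0) =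
      ∫⁻ u, (if p.1.2 + p.2 < u ∧ u < p.1.1 then ENNReal.ofReal (cosKernel u p.1.2 p.2) else 0)
        ∂volumeZeroPi := by
    filter_upwards [ae_volumeCube_mem] with p hp
    split_ifs with h
    · rw [ofReal_halfPosLogRatio_eq_lintegral hp.1.2.1 hp.2.1 h hp.1.1.2,
        ← lintegral_volumeZeroPi_ite _ measurableSet_Ioo
          (Ioo_subset_Ioo (by linarith [hp.1.2.1, hp.2.1]) hp.1.1.2.le)]
      rfl
    · refine ((lintegral_congr fun u => if_neg fun hu => h (hu.1.trans hu.2)).trans ?_).symm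
      simp
  have hm : Measurable (Function.uncurry fun (p : (ℝ × ℝ) × ℝ) (u : ℝ) =>
      if p.1.2 + p.2 < u ∧ u < p.1.1 then ENNReal.ofReal (cosKernel u p.1.2 p.2) else 0) := by
    unfold Function.uncurry cosKernel
    refine Measurable.ite ?_ (Measurable.ennreal_ofReal (by fun_prop)) measurable_const
    rw [ofPred_and]
    refine (measurableSet_lt ?_ ?_).inter (measurableSet_lt ?_ ?_) <;> fun_prop
  rw [lintegral_congr_ae h1, lintegral_lintegral_swap hm.aemeasurable, ← integral_cubic_mul_tan,
    ofReal_integral_eq_lintegral_ofReal integrableOn_cubic_mul_tan]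
  · refine lintegral_congr_ae ?_
    filter_upwards [ae_restrict_mem measurableSet_Ioo, ae_restrict_cos_ne_zero] with u hu hc
    exact lintegral_cube_cosKernel hu hc
  · filter_upwards [ae_restrict_mem measurableSet_Ioo] with u hu
    rw [mul_assoc]
    exact mul_nonneg (mul_nonneg hu.1.le (by linarith [hu.2])) (half_pi_sub_mul_tan_nonneg hu)

lemma measurePreserving_pi_sub :
    MeasurePreserving (fun x => Real.pi - x) volumeZeroPi volumeZeroPi := by
  have h := (volume.measurePreserving_sub_left Real.pi).restrict_preimage
    (measurableSet_Ioo (a := (0 : ℝ)) (b := Real.pi))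
  simpa using h

lemma halfPosLogRatio_comm (a b c : ℝ) : halfPosLogRatio a b c = halfPosLogRatio b a c := by
  unfold halfPosLogRatio; ring_nf

lemma halfPosLogRatio_neg_neg (a b c : ℝ) :
    halfPosLogRatio (-a) b (-c) = halfPosLogRatio a b c := by
  unfold halfPosLogRatio; ring_nf

lemma halfPosLogRatio_cos_eq_zero {t d B : ℝ}
    (hB : B ∈ Ioo 0 Real.pi) (h1 : t ≤ d + B) (h2 : d ≤ t + B) (h3 : B ≤ t + d)
    (h4 : t + d + B ≤ 2 * Real.pi) :
    halfPosLogRatio (Real.cos t) (Real.cos d) (Real.cos B) = 0 := by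
  have e1 : Real.cos B ≤ Real.cos (t - d) := by
    rw [← Real.cos_abs (t - d)]
    exact Real.cos_le_cos_of_nonneg_of_le_pi (abs_nonneg _) hB.2.le
      (abs_le.2 ⟨by linarith, by linarith⟩)
  have e2 : Real.cos (t + d) ≤ Real.cos B := by
    rcases le_total (t + d) Real.pi with h | h
    · exact Real.cos_le_cos_of_nonneg_of_le_pi hB.1.le h h3
    · rw [← Real.cos_two_pi_sub]
      exact Real.cos_le_cos_of_nonneg_of_le_pi hB.1.le (by linarith) (by linarith)
  have key := one_sub_sq_sub_quadratic t d B
  have hs : 0 < 1 - Real.cos B ^ 2 := by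
    rw [← Real.sin_sq]; exact pow_pos (Real.sin_pos_of_pos_of_lt_pi hB.1 hB.2) 2
  have hn : 0 ≤ Real.cos t ^ 2 + Real.cos d ^ 2 - 2 * Real.cos t * Real.cos d * Real.cos B := by
    nlinarith [sq_nonneg (Real.cos t - Real.cos d * Real.cos B),
      mul_nonneg (sq_nonneg (Real.cos d)) hs.le]
  rw [halfPosLogRatio, (Real.posLog_eq_zero_iff _).2, mul_zero]
  rw [abs_of_nonneg (div_nonneg hn hs.le), div_le_one hs]
  nlinarith [mul_nonneg (sub_nonneg.2 e1) (sub_nonneg.2 e2)]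

lemma lintegral_halfPosLogRatio_cube :
    ∫⁻ p, ENNReal.ofReal (halfPosLogRatio (Real.cos p.1.1) (Real.cos p.1.2) (Real.cos p.2))
        ∂volumeCube =
      4 * ENNReal.ofReal (9 / 8 * Real.pi * ∑' n : ℕ, 1 / ((n : ℝ) + 1) ^ 3) := by
  set H : (ℝ × ℝ) × ℝ → ENNReal := fun p =>
    ENNReal.ofReal (halfPosLogRatio (Real.cos p.1.1) (Real.cos p.1.2) (Real.cos p.2)) with hH
  set f : (ℝ × ℝ) × ℝ → ENNReal := fun p => if p.1.2 + p.2 < p.1.1 then H p else 0 with hf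
  have hfm : Measurable f := Measurable.ite (measurableSet_lt (by fun_prop) (by fun_prop))
    measurable_halfPosLogRatio_cos measurable_const
  set σ : (ℝ × ℝ) × ℝ → (ℝ × ℝ) × ℝ := Prod.map Prod.swap id
  set ρ : (ℝ × ℝ) × ℝ → (ℝ × ℝ) × ℝ :=
    Prod.map (Prod.map (fun x => Real.pi - x) id) (fun x => Real.pi - x)
  have hσ : MeasurePreserving σ volumeCube volumeCube :=
    Measure.measurePreserving_swap.prod (MeasurePreserving.id _)
  have hρ : MeasurePreserving ρ volumeCube volumeCube :=
    (measurePreserving_pi_sub.prod (MeasurePreserving.id _)).prod measurePreserving_pi_sub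
  have hHσ : ∀ p, H (σ p) = H p := fun p => by
    simp only [hH, σ, Prod.map, Prod.swap, id]; rw [halfPosLogRatio_comm]
  have hHρ : ∀ p, H (ρ p) = H p := fun p => by
    simp only [hH, ρ, Prod.map, id, Real.cos_pi_sub]; rw [halfPosLogRatio_neg_neg]
  -- The summands live on the disjoint simplices t > d + B, d > t + B, B > t + d and t + d + B > 2π;
  -- outside all four the integrand is 0.
  have hdecomp : ∀ᵐ p ∂volumeCube, H p = f p + f (σ p) + (f (ρ p) + f (σ (ρ p))) := by
    filter_upwards [ae_volumeCube_mem] with p hp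
    simp only [hf, hHσ, hHρ]
    obtain ⟨⟨t, d⟩, B⟩ := p
    obtain ⟨⟨ht, hd⟩, hB⟩ := hp
    simp only [σ, ρ, Prod.map, Prod.swap, id] at ht hd hB ⊢
    have := ht.1; have := ht.2; have := hd.1; have := hd.2; have := hB.1; have := hB.2
    by_cases h1 : d + B < t
    · rw [if_pos h1, if_neg (by linarith), if_neg (by linarith), if_neg (by linarith)]; simp
    by_cases h2 : t + B < d
    · rw [if_neg h1, if_pos h2, if_neg (by linarith), if_neg (by linarith)]; simp
    by_cases h3 : t + d < B
    · rw [if_neg h1, if_neg h2, if_pos (by linarith), if_neg (by linarith)]; simp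
    by_cases h4 : 2 * Real.pi < t + d + B
    · rw [if_neg h1, if_neg h2, if_neg (by linarith), if_pos (by linarith)]; simp
    rw [if_neg h1, if_neg h2, if_neg (by linarith), if_neg (by linarith), hH]
    have := halfPosLogRatio_cos_eq_zero (t := t) (d := d) hB (by linarith) (by linarith)
      (by linarith) (by linarith)
    simp [this]
  have hfσ : Measurable fun p => f (σ p) := hfm.comp hσ.measurable
  have hfρ : Measurable fun p => f (ρ p) := hfm.comp hρ.measurable
  rw [lintegral_congr_ae hdecomp,
    lintegral_add_left (f := fun p => f p + f (σ p)) (hfm.add hfσ),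
    lintegral_add_left hfm, lintegral_add_left hfρ,
    hσ.lintegral_comp hfm, hρ.lintegral_comp hfm, hρ.lintegral_comp (f := fun p => f (σ p)) hfσ,
    hσ.lintegral_comp hfm, hf, lintegral_halfPosLogRatio_region]
  ring

/-! ### From the unit cube to Haar measure on the torus. -/

instance : IsProbabilityMeasure (volume : Measure UnitAddCircle) := ⟨UnitAddCircle.measure_univ⟩

instance : NullSingletonClass (volume : Measure UnitAddCircle) where
  measure_singleton x := by
    refine le_antisymm (ENNReal.le_of_forall_pos_le_add fun ε hε _ => ?_) bot_le
    refine (measure_mono (t := Metric.closedBall x (ε / 2)) ?_).trans ?_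
    · exact singleton_subset_iff.2 (Metric.mem_closedBall_self (by positivity))
    · rw [AddCircle.volume_closedBall, zero_add]
      refine (ENNReal.ofReal_le_ofReal (min_le_right _ _)).trans (le_of_eq ?_)
      rw [mul_div_cancel₀ _ two_ne_zero, ENNReal.ofReal_coe_nnreal]

/-- `log |P|` as a function on the torus `(ℝ/ℤ)^σ`. -/
noncomputable def logNormTorus {σ : Type*} (P : MvPolynomial σ ℂ) (z : σ → UnitAddCircle) : ℝ :=
  Real.log ‖MvPolynomial.eval (fun i => (AddCircle.toCircle (z i) : ℂ)) P‖

lemma toCircle_coe (a : ℝ) :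
    (AddCircle.toCircle (a : UnitAddCircle) : ℂ) = Complex.exp (2 * Real.pi * Complex.I * a) := by
  rw [AddCircle.toCircle_apply_mk, Circle.coe_exp]
  congr 1
  push_cast
  ring

lemma logNormTorus_coe {σ : Type*} (P : MvPolynomial σ ℂ) (θ : σ → ℝ) :
    logNormTorus P (fun i => (θ i : UnitAddCircle)) = logNormOnTorus P θ := by
  simp only [logNormTorus, logNormOnTorus, toCircle_coe]

lemma continuous_toCircle_coe : Continuous fun z : UnitAddCircle => (AddCircle.toCircle z : ℂ) :=
  continuous_subtype_val.comp AddCircle.continuous_toCircle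

lemma measurable_logNormTorus {σ : Type*} [Fintype σ] (P : MvPolynomial σ ℂ) :
    Measurable (logNormTorus P) := by
  have h : Continuous fun z : σ → UnitAddCircle =>
      MvPolynomial.eval (fun i => (AddCircle.toCircle (z i) : ℂ)) P :=
    (MvPolynomial.continuous_eval P).comp
      (continuous_pi fun i => continuous_toCircle_coe.comp (continuous_apply i))
  exact Real.measurable_log.comp h.norm.measurable

lemma measurePreserving_cube_torus (σ : Type*) [Fintype σ] :
    MeasurePreserving (fun (θ : σ → ℝ) (i : σ) => (θ i : UnitAddCircle))
      (volume.restrict (Icc 0 1)) volume := by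
  have h : (volume : Measure (σ → ℝ)).restrict (Icc 0 1) =
      Measure.pi fun _ => volume.restrict (Ioc 0 (0 + 1)) := by
    rw [← pi_univ_Icc, volume_pi, Measure.restrict_pi_pi]
    congr 1
    ext1 i
    rw [zero_add]
    exact (Measure.restrict_congr_set Ioc_ae_eq_Icc).symm
  rw [h]
  exact measurePreserving_pi _ _ fun _ => UnitAddCircle.measurePreserving_mk 0

lemma mahlerIntegrable_iff {σ : Type*} [Fintype σ] (P : MvPolynomial σ ℂ) :
    MahlerIntegrable P ↔ Integrable (logNormTorus P) := by
  rw [← (measurePreserving_cube_torus σ).integrable_comp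
    (measurable_logNormTorus P).aestronglyMeasurable]
  unfold MahlerIntegrable IntegrableOn
  rw [show logNormTorus P ∘ _ = logNormOnTorus P from funext (logNormTorus_coe P)]

lemma mvLogMahlerMeasure_eq {σ : Type*} [Fintype σ] (P : MvPolynomial σ ℂ) :
    mvLogMahlerMeasure P = ∫ z, logNormTorus P z := by
  rw [← (measurePreserving_cube_torus σ).map_eq, integral_map
    (measurePreserving_cube_torus σ).measurable.aemeasurable
    (measurable_logNormTorus P).aestronglyMeasurable]
  simp only [logNormTorus_coe]
  rfl

lemma integral_comp_of_measurePreserving {α β : Type*} [MeasurableSpace α] [MeasurableSpace β]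
    {μ : Measure α} {ν : Measure β} {f : α → β} (hf : MeasurePreserving f μ ν) {g : β → ℝ}
    (hg : Measurable g) : ∫ x, g (f x) ∂μ = ∫ y, g y ∂ν := by
  rw [← hf.map_eq, integral_map hf.measurable.aemeasurable hg.aestronglyMeasurable]

/-! ### Reduction of the determinant. -/

/-- The homomorphism sending the arguments of the entries of a `3 × 3` matrix to those of the
lower right `2 × 2` block after rescaling rows and columns so that the other entries are `1`. -/
def minorHom : (Fin 3 × Fin 3 → UnitAddCircle) →+ (Fin 4 → UnitAddCircle) where
  toFun t := ![t (1, 1) + t (0, 0) - t (1, 0) - t (0, 1), t (2, 2) + t (0, 0) - t (2, 0) - t (0, 2),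
    t (1, 2) + t (0, 0) - t (1, 0) - t (0, 2), t (2, 1) + t (0, 0) - t (2, 0) - t (0, 1)]
  map_zero' := by ext i; fin_cases i <;> simp
  map_add' s t := by ext i; fin_cases i <;> simp <;> abel

lemma measurePreserving_minorHom : MeasurePreserving minorHom := by
  refine AddMonoidHom.measurePreserving ?_ ?_ (by rw [measure_univ, measure_univ])
  · refine continuous_pi fun i => ?_
    fin_cases i <;> simp [minorHom] <;> fun_prop
  · intro y
    refine ⟨fun p => (!![0, 0, 0; 0, y 0, y 2; 0, y 3, y 1] : Matrix (Fin 3) (Fin 3) _) p.1 p.2, ?_⟩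
    ext i
    fin_cases i <;> simp [minorHom]

lemma norm_det_eq (t : Fin 3 × Fin 3 → Circle) :
    ‖MvPolynomial.eval (fun i => (t i : ℂ)) genericDetThree‖ =
      ‖(1 - (t (1, 1) * t (0, 0) / t (1, 0) / t (0, 1) : Circle) : ℂ) *
          (1 - (t (2, 2) * t (0, 0) / t (2, 0) / t (0, 2) : Circle)) -
        (1 - (t (1, 2) * t (0, 0) / t (1, 0) / t (0, 2) : Circle)) *
          (1 - (t (2, 1) * t (0, 0) / t (2, 0) / t (0, 1) : Circle))‖ := by
  -- The factor by which the determinant changes when entry (i, j) is multiplied by t₀₀/(tᵢ₀ t₀ⱼ).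
  set u : Circle := t (0, 0) ^ 3 / (t (0, 0) * t (1, 0) * t (2, 0) * t (0, 0) * t (0, 1) * t (0, 2))
  rw [← one_mul ‖MvPolynomial.eval _ _‖, ← Circle.norm_coe u, ← norm_mul]
  congr 1
  simp only [genericDetThree, Matrix.det_fin_three, Matrix.mvPolynomialX_apply, map_sub, map_add,
    map_mul, MvPolynomial.eval_X, u, Circle.coe_mul, Circle.coe_div, Circle.coe_pow]
  have h := fun i => Circle.coe_ne_zero (t i)
  have h1 := h (0, 0); have h2 := h (1, 0); have h3 := h (2, 0); have h4 := h (0, 1)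
  have h5 := h (0, 2)
  field_simp
  ring

lemma logNormTorus_genericDetThree (t : Fin 3 × Fin 3 → UnitAddCircle) :
    logNormTorus genericDetThree t = logNormTorus fourVarPoly (minorHom t) := by
  rw [logNormTorus, logNormTorus, norm_det_eq]
  simp [fourVarPoly, minorHom, AddCircle.toCircle_add, sub_eq_add_neg, AddCircle.toCircle_neg,
    div_eq_mul_inv]

lemma genericDetThree_reduction (h : MahlerIntegrable fourVarPoly) :
    MahlerIntegrable genericDetThree ∧
      mvLogMahlerMeasure genericDetThree = mvLogMahlerMeasure fourVarPoly := by
  have he : logNormTorus genericDetThree = logNormTorus fourVarPoly ∘ minorHom :=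
    funext logNormTorus_genericDetThree
  have hm := measurable_logNormTorus fourVarPoly
  rw [mahlerIntegrable_iff] at h ⊢
  refine ⟨?_, ?_⟩
  · rw [he, measurePreserving_minorHom.integrable_comp hm.aestronglyMeasurable]
    exact h
  · rw [mvLogMahlerMeasure_eq, mvLogMahlerMeasure_eq, he]
    exact integral_comp_of_measurePreserving measurePreserving_minorHom hm

/-! ### Jensen's formula on the circle. -/

lemma integral_comp_toCircle (f : ℂ → ℝ) :
    ∫ z : UnitAddCircle, f (AddCircle.toCircle z) = Real.circleAverage f 0 1 := by
  rw [← UnitAddCircle.intervalIntegral_preimage 0, Real.circleAverage]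
  have := intervalIntegral.integral_comp_mul_left (a := 0) (b := 1) (c := 2 * Real.pi)
    (fun x => f (circleMap 0 1 x)) (by positivity)
  rw [mul_zero, mul_one] at this
  rw [← this, zero_add]
  refine intervalIntegral.integral_congr fun a _ => ?_
  simp only [toCircle_coe, circleMap]
  congr 1
  push_cast
  simp
  ring_nf

lemma integrable_comp_toCircle {f : ℂ → ℝ} (hm : Measurable f) (hf : CircleIntegrable f 0 1) :
    Integrable fun z : UnitAddCircle => f (AddCircle.toCircle z) := by
  have hiff := (UnitAddCircle.measurePreserving_mk 0).integrable_comp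
    (g := fun z : UnitAddCircle => f (AddCircle.toCircle z))
    (hm.comp continuous_toCircle_coe.measurable).aestronglyMeasurable
  refine hiff.1 ?_
  have h := (IntervalIntegrable.comp_mul_left hf (c := 2 * Real.pi))
  rw [zero_div, div_self (by positivity), intervalIntegrable_iff_integrableOn_Ioc_of_le
    zero_le_one] at h
  rw [zero_add]
  refine h.congr (Filter.Eventually.of_forall fun a => ?_)
  simp only [Function.comp, toCircle_coe, circleMap]
  congr 1
  push_cast
  simp
  ring_nf

lemma ae_toCircle_ne (a : ℂ) : ∀ᵐ z : UnitAddCircle, (AddCircle.toCircle z : ℂ) ≠ a := by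
  refine Set.Subsingleton.measure_zero (fun z hz w hw => ?_) _
  have hz' : (AddCircle.toCircle z : ℂ) = a := by simpa using hz
  have hw' : (AddCircle.toCircle w : ℂ) = a := by simpa using hw
  exact AddCircle.injective_toCircle one_ne_zero (Subtype.ext (hz'.trans hw'.symm))

lemma log_norm_add_mul_ae (a : ℂ) {b : ℂ} (hb : b ≠ 0) :
    (fun z : UnitAddCircle => Real.log ‖a + b * AddCircle.toCircle z‖) =ᵐ[volume]
      fun z => Real.log ‖b‖ + Real.log ‖(AddCircle.toCircle z : ℂ) - (-(a / b))‖ := by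
  filter_upwards [ae_toCircle_ne (-(a / b))] with z hz
  rw [← Real.log_mul (norm_ne_zero_iff.2 hb) (norm_ne_zero_iff.2 (sub_ne_zero.2 hz)), ← norm_mul]
  congr 2
  field_simp
  ring

lemma integrable_log_norm_toCircle_sub (a : ℂ) :
    Integrable fun z : UnitAddCircle => Real.log ‖(AddCircle.toCircle z : ℂ) - a‖ :=
  integrable_comp_toCircle (f := fun z => Real.log ‖z - a‖) (by fun_prop)
    (circleIntegrable_log_norm_sub_const 1)

lemma integral_log_norm_toCircle_sub (a : ℂ) :
    ∫ z : UnitAddCircle, Real.log ‖(AddCircle.toCircle z : ℂ) - a‖ = Real.posLog ‖a‖ :=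
  (integral_comp_toCircle fun z => Real.log ‖z - a‖).trans
    circleAverage_log_norm_sub_const_eq_posLog

lemma integrable_log_norm_add_mul (a : ℂ) {b : ℂ} (hb : b ≠ 0) :
    Integrable fun z : UnitAddCircle => Real.log ‖a + b * AddCircle.toCircle z‖ :=
  ((integrable_const _).add (integrable_log_norm_toCircle_sub _)).congr
    (log_norm_add_mul_ae a hb).symm

lemma integral_log_norm_add_mul (a : ℂ) {b : ℂ} (hb : b ≠ 0) :
    ∫ z : UnitAddCircle, Real.log ‖a + b * AddCircle.toCircle z‖ =
      Real.log ‖b‖ + Real.posLog (‖a‖ / ‖b‖) := by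
  rw [integral_congr_ae (log_norm_add_mul_ae a hb), integral_add (integrable_const _)
    (integrable_log_norm_toCircle_sub _), integral_log_norm_toCircle_sub, norm_neg, norm_div]
  simp

/-! ### The distribution of cosines and the change of coordinates. -/

/-- The Haar probability measure on `(ℝ/ℤ)³`. -/
noncomputable abbrev haarThree : Measure ((UnitAddCircle × UnitAddCircle) × UnitAddCircle) :=
  ((volume : Measure UnitAddCircle).prod volume).prod volume

instance : Measure.IsAddHaarMeasure ((volume : Measure UnitAddCircle).prod
    (volume : Measure UnitAddCircle)) := Measure.prod.instIsAddHaarMeasure _ _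

instance : Measure.IsAddHaarMeasure haarThree := by
  exact Measure.prod.instIsAddHaarMeasure _ _

instance : Measure.IsAddHaarMeasure (haarThree.prod (volume : Measure UnitAddCircle)) := by
  exact Measure.prod.instIsAddHaarMeasure _ _

/-- The cosine `cos (2πz)` of a point `z` of `ℝ/ℤ`. -/
noncomputable def circleCos (z : UnitAddCircle) : ℝ := (AddCircle.toCircle z : ℂ).re

lemma continuous_circleCos : Continuous circleCos :=
  Complex.continuous_re.comp continuous_toCircle_coe

lemma circleCos_coe (a : ℝ) : circleCos (a : UnitAddCircle) = Real.cos (2 * Real.pi * a) := by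
  rw [circleCos, toCircle_coe, ← Complex.exp_ofReal_mul_I_re]
  congr 2
  push_cast
  ring

lemma setLIntegral_comp_mul_left (g : ℝ → ENNReal) (hg : Measurable g) {c : ℝ} (hc : c ≠ 0)
    {s : Set ℝ} (hs : MeasurableSet s) :
    ∫⁻ x in (fun x => c * x) ⁻¹' s, g (c * x) = ENNReal.ofReal |c⁻¹| * ∫⁻ x in s, g x := by
  have hm : Measurable fun x : ℝ => c * x := measurable_const_mul c
  rw [← lintegral_map hg hm, ← Measure.restrict_map hm hs, Real.map_volume_mul_left hc,
    Measure.restrict_smul, lintegral_smul_measure, smul_eq_mul]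

lemma lintegral_Ioc_neg_pi_pi_comp_cos (f : ℝ → ENNReal) :
    ∫⁻ x in Ioc (-Real.pi) Real.pi, f (Real.cos x) =
      2 * ∫⁻ x in Ioo 0 Real.pi, f (Real.cos x) := by
  have hpi := Real.pi_pos
  rw [← Ioc_union_Ioc_eq_Ioc (by linarith : -Real.pi ≤ 0) hpi.le,
    lintegral_union measurableSet_Ioc (Ioc_disjoint_Ioc_of_le le_rfl)]
  have h1 : ∫⁻ x in Ioc (-Real.pi) 0, f (Real.cos x) = ∫⁻ x in Ioo 0 Real.pi, f (Real.cos x) := by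
    have h := ((Measure.measurePreserving_neg (volume : Measure ℝ)).restrict_preimage
      (measurableSet_Ioo (a := (0 : ℝ)) (b := Real.pi)))
    have h2 := h.lintegral_comp_emb (MeasurableEquiv.neg ℝ).measurableEmbedding
      (fun x => f (Real.cos x))
    rw [← h2, restrict_Ioo_eq_restrict_Ioc.symm]
    simp
  rw [h1, two_mul, ← restrict_Ioo_eq_restrict_Ioc]

/-- Evenness of the cosine folds a full period (-π, π] onto (0, π), and 2 · 1/(2π) = 1/π. -/
lemma map_circleCos : Measure.map circleCos volume =
    ENNReal.ofReal Real.pi⁻¹ • Measure.map Real.cos volumeZeroPi := by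
  refine Measure.ext_of_lintegral _ fun f hf => ?_
  rw [lintegral_smul_measure, lintegral_map hf continuous_circleCos.measurable,
    lintegral_map hf Real.measurable_cos, ← UnitAddCircle.lintegral_preimage (-(1 / 2))]
  have hpi := Real.pi_pos
  have hset : Ioc (-(1 / 2) : ℝ) (-(1 / 2) + 1) =
      (fun x => 2 * Real.pi * x) ⁻¹' Ioc (-Real.pi) Real.pi := by
    ext x
    simp only [mem_Ioc, mem_preimage]
    constructor <;> rintro ⟨h1, h2⟩ <;> constructor <;> nlinarith
  simp only [circleCos_coe]
  rw [hset, setLIntegral_comp_mul_left (fun x => f (Real.cos x)) (hf.comp Real.measurable_cos)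
    (by positivity) measurableSet_Ioc, lintegral_Ioc_neg_pi_pi_comp_cos, ← mul_assoc, smul_eq_mul,
    abs_of_pos (by positivity), ← ENNReal.ofReal_ofNat 2, ← ENNReal.ofReal_mul (by positivity)]
  congr 2
  field_simp

lemma lintegral_haarThree_circleCos (F : (ℝ × ℝ) × ℝ → ENNReal) (hF : Measurable F) :
    ∫⁻ p, F ((circleCos p.1.1, circleCos p.1.2), circleCos p.2) ∂haarThree =
      ENNReal.ofReal Real.pi⁻¹ ^ 3 *
        ∫⁻ p, F ((Real.cos p.1.1, Real.cos p.1.2), Real.cos p.2) ∂volumeCube := by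
  have hc := continuous_circleCos.measurable
  have hr := Real.measurable_cos
  have h1 := lintegral_map (μ := haarThree) hF ((hc.prodMap hc).prodMap hc)
  have h2 := lintegral_map (μ := volumeCube) hF ((hr.prodMap hr).prodMap hr)
  refine h1.symm.trans ?_
  refine Eq.trans ?_ (congrArg _ h2)
  rw [← Measure.map_prod_map _ _ (hc.prodMap hc) hc, ← Measure.map_prod_map _ _ hc hc,
    ← Measure.map_prod_map _ _ (hr.prodMap hr) hr, ← Measure.map_prod_map _ _ hr hr,
    map_circleCos]
  simp only [Measure.prod_smul_left, Measure.prod_smul_right]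
  rw [smul_smul, smul_smul, lintegral_smul_measure, smul_eq_mul]
  ring

/-- The coordinates `(t, d, B, z) ↦ (B - t + d, B - t - d, 2B, z)` on `(ℝ/ℤ)⁴`. -/
def shearHom : ((UnitAddCircle × UnitAddCircle) × UnitAddCircle) × UnitAddCircle →+
    (Fin 4 → UnitAddCircle) where
  toFun p := ![p.1.2 - p.1.1.1 + p.1.1.2, p.1.2 - p.1.1.1 - p.1.1.2, p.1.2 + p.1.2, p.2]
  map_zero' := by ext i; fin_cases i <;> simp
  map_add' s t := by ext i; fin_cases i <;> simp <;> abel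

lemma exists_add_self_eq (x : UnitAddCircle) : ∃ y, y + y = x := by
  induction x using QuotientAddGroup.induction_on with
  | H a => exact ⟨((a / 2 : ℝ) : UnitAddCircle), by rw [← AddCircle.coe_add, add_halves]⟩

/-- The map is not injective, but surjectivity is enough: the image of a Haar probability measure is
again one. Divisibility of ℝ/ℤ by 2 supplies preimages. -/
lemma measurePreserving_shearHom :
    MeasurePreserving shearHom (haarThree.prod volume) volume := by
  refine AddMonoidHom.measurePreserving ?_ ?_ (by rw [measure_univ, measure_univ])
  · refine continuous_pi fun i => ?_
    fin_cases i <;> simp [shearHom] <;> fun_prop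
  · intro y
    obtain ⟨d, hd⟩ := exists_add_self_eq (y 0 - y 1)
    obtain ⟨B, hB⟩ := exists_add_self_eq (y 2)
    refine ⟨(((B - y 0 + d, d), B), y 3), ?_⟩
    ext i
    fin_cases i
    · simp [shearHom]; abel
    · have : y 1 = y 0 - (d + d) := by rw [hd]; abel
      simp [shearHom, this]; abel
    · simp [shearHom, hB]
    · simp [shearHom]

/-- The doubling `(t, d, B) ↦ 2B`. -/
def doubleHom : (UnitAddCircle × UnitAddCircle) × UnitAddCircle →+ UnitAddCircle where
  toFun p := p.2 + p.2
  map_zero' := by simp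
  map_add' s t := by simp; abel

lemma measurePreserving_doubleHom : MeasurePreserving doubleHom haarThree volume := by
  refine AddMonoidHom.measurePreserving ?_ ?_ (by rw [measure_univ, measure_univ])
  · change Continuous fun p : (UnitAddCircle × UnitAddCircle) × UnitAddCircle => p.2 + p.2
    fun_prop
  · intro y
    obtain ⟨B, hB⟩ := exists_add_self_eq y
    exact ⟨((0, 0), B), hB⟩

/-! ### The two coefficients in z and their absolute values. -/

/-- The coefficient of `z` in `(1 - x)(1 - y) - (1 - w)(1 - z)` in the coordinates of
`shearHom`. -/
noncomputable def linearCoeff (p : (UnitAddCircle × UnitAddCircle) × UnitAddCircle) : ℂ :=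
  1 - AddCircle.toCircle (p.2 + p.2)

/-- The coefficient of `1` in `(1 - x)(1 - y) - (1 - w)(1 - z)`, as a polynomial in `z`, in the
coordinates of `shearHom`. -/
noncomputable def constCoeff (p : (UnitAddCircle × UnitAddCircle) × UnitAddCircle) : ℂ :=
  (1 - AddCircle.toCircle (p.2 - p.1.1 + p.1.2)) * (1 - AddCircle.toCircle (p.2 - p.1.1 - p.1.2)) -
    linearCoeff p

lemma logNormTorus_shearHom (p : (UnitAddCircle × UnitAddCircle) × UnitAddCircle)
    (z : UnitAddCircle) : logNormTorus fourVarPoly (shearHom (p, z)) =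
      Real.log ‖constCoeff p + linearCoeff p * AddCircle.toCircle z‖ := by
  rw [logNormTorus]
  congr 2
  simp [fourVarPoly, shearHom, constCoeff, linearCoeff]
  ring

lemma normSq_one_sub_sq {β : ℂ} (hβ : β.re ^ 2 + β.im ^ 2 = 1) :
    Complex.normSq (1 - β * β) = 4 * (1 - β.re ^ 2) := by
  rw [Complex.normSq_apply]
  simp only [Complex.sub_re, Complex.sub_im, Complex.one_re, Complex.one_im, Complex.mul_re,
    Complex.mul_im]
  have : β.im ^ 2 = 1 - β.re ^ 2 := by linarith
  linear_combination (β.im ^ 2 + β.re ^ 2 + 3) * this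

lemma circle_re_sq_add_im_sq (u : Circle) : (u : ℂ).re ^ 2 + (u : ℂ).im ^ 2 = 1 := by
  have := Circle.normSq_coe u
  rw [Complex.normSq_apply] at this
  linarith

lemma norm_linearCoeff_sq (p : (UnitAddCircle × UnitAddCircle) × UnitAddCircle) :
    ‖linearCoeff p‖ ^ 2 = 4 * (1 - circleCos p.2 ^ 2) := by
  rw [← Complex.normSq_eq_norm_sq, linearCoeff, AddCircle.toCircle_add, Circle.coe_mul,
    normSq_one_sub_sq (circle_re_sq_add_im_sq _)]
  rfl

lemma norm_constCoeff_sq (p : (UnitAddCircle × UnitAddCircle) × UnitAddCircle) :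
    ‖constCoeff p‖ ^ 2 = 4 * (circleCos p.1.1 ^ 2 + circleCos p.1.2 ^ 2 -
      2 * circleCos p.1.1 * circleCos p.1.2 * circleCos p.2) := by
  obtain ⟨⟨t, d⟩, B⟩ := p
  have hre : ∀ z : UnitAddCircle, (2 * circleCos z : ℂ) =
      AddCircle.toCircle z + (AddCircle.toCircle z : ℂ)⁻¹ := by
    intro z
    rw [← Circle.coe_inv, Circle.coe_inv_eq_conj, Complex.add_conj]
    simp [circleCos]
  -- The shear is chosen for this: xy and w combine into cos t, x and y into cos d, up to a common
  -- unimodular factor.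
  have h : constCoeff ((t, d), B) = ((AddCircle.toCircle B / AddCircle.toCircle t : Circle) : ℂ) *
      (2 * (circleCos t * AddCircle.toCircle B - circleCos d)) := by
    have ht := Circle.coe_ne_zero (AddCircle.toCircle t)
    have hd := Circle.coe_ne_zero (AddCircle.toCircle d)
    have e : (2 * (circleCos t * (AddCircle.toCircle B : ℂ) - circleCos d) : ℂ) =
        (2 * circleCos t) * AddCircle.toCircle B - 2 * circleCos d := by ring
    rw [e, hre, hre]
    simp only [constCoeff, linearCoeff, sub_eq_add_neg, AddCircle.toCircle_add,
      AddCircle.toCircle_neg, Circle.coe_mul, Circle.coe_inv, Circle.coe_div]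
    field_simp
    ring
  rw [h, norm_mul, Circle.norm_coe, one_mul, ← Complex.normSq_eq_norm_sq, Complex.normSq_apply]
  have hB := circle_re_sq_add_im_sq (AddCircle.toCircle B)
  have hc : (AddCircle.toCircle B : ℂ).re = circleCos B := rfl
  rw [hc] at hB
  simp [hc]
  linear_combination (4 * circleCos t ^ 2) * hB

lemma posLog_norm_div_norm (p : (UnitAddCircle × UnitAddCircle) × UnitAddCircle) :
    Real.posLog (‖constCoeff p‖ / ‖linearCoeff p‖) =
      halfPosLogRatio (circleCos p.1.1) (circleCos p.1.2) (circleCos p.2) := by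
  rw [halfPosLogRatio, ← mul_div_mul_left _ (1 - circleCos p.2 ^ 2) (four_ne_zero (α := ℝ)),
    ← norm_linearCoeff_sq p, ← norm_constCoeff_sq p, ← div_pow, Real.posLog_pow]
  push_cast
  ring

lemma log_norm_linearCoeff_eq (p : (UnitAddCircle × UnitAddCircle) × UnitAddCircle) :
    Real.log ‖linearCoeff p‖ = Real.log ‖(AddCircle.toCircle (doubleHom p) : ℂ) - 1‖ := by
  rw [linearCoeff, norm_sub_rev]; rfl

lemma measurable_log_norm_toCircle_sub_one :
    Measurable fun z : UnitAddCircle => Real.log ‖(AddCircle.toCircle z : ℂ) - 1‖ :=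
  Real.measurable_log.comp
    ((continuous_toCircle_coe.sub continuous_const).norm.measurable)

lemma integrable_log_norm_linearCoeff :
    Integrable (fun p => Real.log ‖linearCoeff p‖) haarThree := by
  simp only [log_norm_linearCoeff_eq]
  exact (measurePreserving_doubleHom.integrable_comp
    measurable_log_norm_toCircle_sub_one.aestronglyMeasurable).2
    (integrable_log_norm_toCircle_sub 1)

/-- Doubling preserves Haar measure, so this is the Mahler measure of the one-variable polynomial w
- 1, namely log⁺ 1. -/
lemma integral_log_norm_linearCoeff : ∫ p, Real.log ‖linearCoeff p‖ ∂haarThree = 0 := by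
  simp only [log_norm_linearCoeff_eq]
  rw [integral_comp_of_measurePreserving measurePreserving_doubleHom
    measurable_log_norm_toCircle_sub_one, integral_log_norm_toCircle_sub]
  simp

lemma ae_linearCoeff_ne_zero : ∀ᵐ p ∂haarThree, linearCoeff p ≠ 0 := by
  filter_upwards [measurePreserving_doubleHom.quasiMeasurePreserving.ae (ae_toCircle_ne 1)]
    with p hp h
  exact hp (sub_eq_zero.1 h).symm

lemma measurable_halfPosLogRatio_circleCos :
    Measurable fun p : (UnitAddCircle × UnitAddCircle) × UnitAddCircle =>
      halfPosLogRatio (circleCos p.1.1) (circleCos p.1.2) (circleCos p.2) := by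
  have hc := continuous_circleCos.measurable
  have hp := Real.continuous_posLog.measurable
  unfold halfPosLogRatio
  fun_prop

lemma halfPosLogRatio_nonneg (a b c : ℝ) : 0 ≤ halfPosLogRatio a b c :=
  mul_nonneg (by norm_num) Real.posLog_nonneg

/-! ### Absolute convergence and the final value. -/

lemma lintegral_halfPosLogRatio_circleCos :
    ∫⁻ p, ENNReal.ofReal (halfPosLogRatio (circleCos p.1.1) (circleCos p.1.2) (circleCos p.2))
      ∂haarThree =
      ENNReal.ofReal (9 / (2 * Real.pi ^ 2) * ∑' n : ℕ, 1 / ((n : ℝ) + 1) ^ 3) := by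
  rw [lintegral_haarThree_circleCos
    (fun q => ENNReal.ofReal (halfPosLogRatio q.1.1 q.1.2 q.2))
    measurable_halfPosLogRatio.ennreal_ofReal, lintegral_halfPosLogRatio_cube,
    ← ENNReal.ofReal_pow (by positivity), ← ENNReal.ofReal_ofNat 4,
    ← ENNReal.ofReal_mul (by positivity), ← ENNReal.ofReal_mul (by positivity)]
  congr 1
  have := Real.pi_ne_zero
  field_simp
  ring

lemma integrable_halfPosLogRatio_circleCos :
    Integrable (fun p => halfPosLogRatio (circleCos p.1.1) (circleCos p.1.2) (circleCos p.2))
      haarThree := by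
  refine ⟨measurable_halfPosLogRatio_circleCos.aestronglyMeasurable, ?_⟩
  rw [hasFiniteIntegral_iff_ofReal (Filter.Eventually.of_forall fun p =>
    halfPosLogRatio_nonneg _ _ _), lintegral_halfPosLogRatio_circleCos]
  exact ENNReal.ofReal_lt_top

lemma integral_halfPosLogRatio_circleCos :
    ∫ p, halfPosLogRatio (circleCos p.1.1) (circleCos p.1.2) (circleCos p.2) ∂haarThree =
      9 / (2 * Real.pi ^ 2) * ∑' n : ℕ, 1 / ((n : ℝ) + 1) ^ 3 := by
  rw [integral_eq_lintegral_of_nonneg_ae (Filter.Eventually.of_forall fun p =>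
    halfPosLogRatio_nonneg _ _ _) measurable_halfPosLogRatio_circleCos.aestronglyMeasurable,
    lintegral_halfPosLogRatio_circleCos, ENNReal.toReal_ofReal]
  exact mul_nonneg (by positivity) (tsum_nonneg fun n => by positivity)

lemma log_norm_fourVarPoly_le (θ : Fin 4 → UnitAddCircle) :
    logNormTorus fourVarPoly θ ≤ Real.log 8 := by
  have h1 : ∀ z : UnitAddCircle, ‖1 - (AddCircle.toCircle z : ℂ)‖ ≤ 2 := fun z =>
    (norm_sub_le _ _).trans (by rw [Circle.norm_coe, norm_one]; norm_num)
  have h2 : ‖MvPolynomial.eval (fun i => (AddCircle.toCircle (θ i) : ℂ)) fourVarPoly‖ ≤ 8 := by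
    simp only [fourVarPoly, map_sub, map_mul, map_one, MvPolynomial.eval_X]
    refine (norm_sub_le _ _).trans ?_
    rw [norm_mul, norm_mul]
    have := mul_le_mul (h1 (θ 0)) (h1 (θ 1)) (norm_nonneg _) zero_le_two
    have := mul_le_mul (h1 (θ 2)) (h1 (θ 3)) (norm_nonneg _) zero_le_two
    linarith
  rw [logNormTorus]
  rcases (norm_nonneg (MvPolynomial.eval (fun i => (AddCircle.toCircle (θ i) : ℂ))
    fourVarPoly)).eq_or_lt with h | h
  -- At zeros of the polynomial the logarithm takes the default value 0, so the bound needs log 8 ≥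
  -- 0.
  · rw [← h, Real.log_zero]; exact Real.log_nonneg (by norm_num)
  · exact Real.log_le_log h h2

lemma integral_logNormTorus_shearHom {p : (UnitAddCircle × UnitAddCircle) × UnitAddCircle}
    (hp : linearCoeff p ≠ 0) : ∫ z, logNormTorus fourVarPoly (shearHom (p, z)) =
      Real.log ‖linearCoeff p‖ +
        halfPosLogRatio (circleCos p.1.1) (circleCos p.1.2) (circleCos p.2) := by
  simp only [logNormTorus_shearHom]
  rw [integral_log_norm_add_mul _ hp, posLog_norm_div_norm]

/-- An upper bound L ≤ log 8 yields |L| ≤ 2 log 8 - L, so the z-integral of |L| is controlled by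
that of L, which Jensen's formula expresses through two integrable functions. -/
lemma integrable_logNormTorus_shearHom :
    Integrable (fun q => logNormTorus fourVarPoly (shearHom q)) (haarThree.prod volume) := by
  have hm : Measurable fun q => logNormTorus fourVarPoly (shearHom q) :=
    (measurable_logNormTorus _).comp measurePreserving_shearHom.measurable
  have hslice : ∀ᵐ p ∂haarThree,
      Integrable (fun z => logNormTorus fourVarPoly (shearHom (p, z))) := by
    filter_upwards [ae_linearCoeff_ne_zero] with p hp
    simp only [logNormTorus_shearHom]
    exact integrable_log_norm_add_mul _ hp
  rw [integrable_prod_iff hm.aestronglyMeasurable]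
  refine ⟨hslice, ?_⟩
  refine Integrable.mono' (((integrable_const (2 * Real.log 8)).sub
    integrable_log_norm_linearCoeff).sub integrable_halfPosLogRatio_circleCos)
    (hm.norm.stronglyMeasurable.integral_prod_right.aestronglyMeasurable) ?_
  filter_upwards [hslice, ae_linearCoeff_ne_zero] with p hp hb
  rw [Real.norm_of_nonneg (integral_nonneg fun z => norm_nonneg _)]
  have hle : ∫ z, ‖logNormTorus fourVarPoly (shearHom (p, z))‖ ≤
      ∫ z, (2 * Real.log 8 - logNormTorus fourVarPoly (shearHom (p, z))) := by
    refine integral_mono hp.norm ((integrable_const _).sub hp) fun z => ?_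
    have h1 := log_norm_fourVarPoly_le (shearHom (p, z))
    have h2 : 0 ≤ Real.log 8 := Real.log_nonneg (by norm_num)
    exact abs_le.2 ⟨by linarith, by linarith⟩
  rw [integral_sub (integrable_const _) hp, integral_logNormTorus_shearHom hb] at hle
  simp at hle ⊢
  linarith

lemma mahlerIntegrable_fourVarPoly : MahlerIntegrable fourVarPoly := by
  rw [mahlerIntegrable_iff, ← measurePreserving_shearHom.integrable_comp
    (measurable_logNormTorus _).aestronglyMeasurable]
  exact integrable_logNormTorus_shearHom

lemma mvLogMahlerMeasure_fourVarPoly : mvLogMahlerMeasure fourVarPoly =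
    9 / (2 * Real.pi ^ 2) * ∑' n : ℕ, 1 / ((n : ℝ) + 1) ^ 3 := by
  rw [mvLogMahlerMeasure_eq, ← integral_comp_of_measurePreserving measurePreserving_shearHom
    (measurable_logNormTorus _), integral_prod _ integrable_logNormTorus_shearHom]
  have h : ∀ᵐ p ∂haarThree, ∫ z, logNormTorus fourVarPoly (shearHom (p, z)) =
      Real.log ‖linearCoeff p‖ +
        halfPosLogRatio (circleCos p.1.1) (circleCos p.1.2) (circleCos p.2) :=
    ae_linearCoeff_ne_zero.mono fun p hp => integral_logNormTorus_shearHom hp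
  rw [integral_congr_ae h, integral_add integrable_log_norm_linearCoeff
    integrable_halfPosLogRatio_circleCos, integral_log_norm_linearCoeff,
    integral_halfPosLogRatio_circleCos, zero_add]

theorem mainTheorem3 :
    (MahlerIntegrable fourVarPoly ∧
      (mvLogMahlerMeasure fourVarPoly : ℂ) = 9 / (2 * (Real.pi : ℂ) ^ 2) * riemannZeta 3) ∧
    (MahlerIntegrable genericDetThree ∧
      mvLogMahlerMeasure genericDetThree = mvLogMahlerMeasure fourVarPoly) := by
  refine ⟨⟨mahlerIntegrable_fourVarPoly, ?_⟩, genericDetThree_reduction mahlerIntegrable_fourVarPoly⟩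
  rw [mvLogMahlerMeasure_fourVarPoly, zeta_eq_tsum_one_div_nat_add_one_cpow (by norm_num)]
  push_cast
  congr 2
  ext n
  norm_cast
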